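/- Let $K\subset S^3$ be the figure eight knot, $\omega=-\tfrac12+\tfrac{\sqrt3}{2}i$, and let $\mathbb Z[\omega]$ be the ring of Eisenstein integers. **The canonical hyperbolic structure.** Let $\Gamma\subset \mathrm{SL}_2(\mathbb C)$ be the image of $\pi_1(S^3\setminus K)=\langle x,y\mid y=wxw^{-1}\rangle$, $w=x^{-1}yxy^{-1}$, under the holonomy representation $x\mapsto\begin{pmatrix}1&1\\0&1\end{pmatrix}$, $y\mapsto\begin{pmatrix}1&0\\-\omega&1\end{pmatrix}$, so that $S^3\setminus K\cong\mathbb H^3/\Gamma$, where $\mathbb H^3=\{(z,t)\in\mathbb C\times\mathbb R: t>0\}$. Expand the horoball $\{t>h\}$ (decreasing $h$) as long as each of its $\Gamma$-translates is equal to it or disjoint from it; the boundaries of the $\Gamma$-translates of the largest such horoball are the *canonical horospheres*. Decorate the canonical horosphere centred at $\infty$ by the parallel unit tangent field in the direction $i\in\mathbb C$, and every other canonical horosphere by the $\Gamma$-translates of this field (which is well defined). **Spin-decorations.** Let $\mathfrak h$ be a horosphere with a parallel unit tangent field $V$. Its inward (resp. outward) frame field is $(N,V,N\times V)$, where $N$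 is the unit normal pointing out of (resp. into) the horoball bounded by $\mathfrak h$. A *spin-decoration* over $V$ is a pair $(W^{in},W^{out})$ of continuous lifts of the inward and outward frame fields to the double cover $\mathrm{SL}_2(\mathbb C)\to\mathrm{PSL}_2(\mathbb C)$ of the frame bundle of $\mathbb H^3$, such that $W^{out}$ is obtained from $W^{in}$ by rotation through $-\pi$ about $V$. The *spin-decorated canonical horospheres* are the canonical horospheres, each with either of the two spin-decorations over its decoration. **Complex $\lambda$-length.** Let $\mathfrak h,\mathfrak h'$ be spin-decorated horospheres with distinct centres. Let $\gamma$ be the geodesic oriented from the centre of $\mathfrak h$ to that of $\mathfrak h'$; it meets $\mathfrak h$ and $\mathfrak h'$ orthogonally at points $p$ and $p'$. Let $\rho$ be the signed distance from $p$ to $p'$ along $\gamma$, and let $\theta\in\mathbb R/4\pi\mathbb Z$ be the angle of the rotation about $\gamma$ that takes the parallel transport along $\gamma$ to $p'$ of the inward spin frame of $\mathfrak h$ at $p$ to the outward spin frame of $\mathfrak h'$ at $p'$. The complex $\lambda$-length from $\mathfrak h$ to $\mathfrak h'$ is $\lambda=e^{(\rho+i\theta)/2}$. If $\mathfrak h,\mathfrak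 h'$ have the same centre, put $\lambda=0$. **Theorem.** The complex $\lambda$-length from any spin-decorated canonical horosphere of $S^3\setminus K$ to any other (or the same) one is well defined and is an Eisenstein integer. Moreover, for every $\alpha\in\mathbb Z[\omega]$ there is a unit $u$ of $\mathbb Z[\omega]$ such that $u\alpha$ is the $\lambda$-length from one spin-decorated canonical horosphere of $S^3\setminus K$ to another (or to itself). -/

import Mathlib

noncomputable section

/-- `SL₂(ℂ)`. -/
abbrev SLC : Type := Matrix.SpecialLinearGroup (Fin 2) ℂ

/-! ### Eisenstein integers -/

/-- The primitive cube root of unity `ω = -1/2 + (√3/2) i`. -/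
def omega : ℂ := -1 / 2 + (Real.sqrt 3 / 2 : ℝ) * Complex.I

/-- The ring `ℤ[ω]` of Eisenstein integers, as a subring of `ℂ`. -/
def eisenstein : Subalgebra ℤ ℂ := Algebra.adjoin ℤ {omega}

lemma omega_relation : omega ^ 2 + omega + 1 = 0 := by
  have h : ((Real.sqrt 3 : ℝ) : ℂ) ^ 2 = 3 := by
    rw [← Complex.ofReal_pow, Real.sq_sqrt (by norm_num)]
    norm_num
  simp only [omega]
  push_cast
  ring_nf
  rw [Complex.I_sq, h]
  ring

/-! ### The figure eight knot group and its holonomy -/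

/-- The image `A` of the first meridian. -/
def matA : SLC := ⟨!![1, 1; 0, 1], by simp⟩

/-- The image `B` of the second meridian. -/
def matB : SLC := ⟨!![1, 0; -omega, 1], by simp⟩

/-- The images of the two Wirtinger generators `x` (`false`) and `y` (`true`). -/
def meridianImage : Bool → SLC
  | false => matA
  | true => matB

/-- The Wirtinger relator `y⁻¹ w x w⁻¹`, `w = x⁻¹ y x y⁻¹`, of the figure eight knot. -/
def knotRelator : FreeGroup Bool :=
  let x := FreeGroup.of false
  let y := FreeGroup.of true
  let w := x⁻¹ * y * x * y⁻¹
  y⁻¹ * (w * x * w⁻¹)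

/-- The group `π₁(S³ ∖ K) = ⟨x, y ∣ y = w x w⁻¹⟩` of the figure eight knot `K`. -/
abbrev FigureEightGroup : Type := PresentedGroup {knotRelator}

lemma meridianImage_relator :
    ∀ r ∈ ({knotRelator} : Set (FreeGroup Bool)), FreeGroup.lift meridianImage r = 1 := by
  intro r hr
  rw [Set.mem_singleton_iff] at hr
  subst hr
  have key : matB * (matA⁻¹ * matB * matA * matB⁻¹) = (matA⁻¹ * matB * matA * matB⁻¹) * matA := by
    have hA : (matA⁻¹ : SLC).1 = !![1, -1; 0, 1] := by
      rw [Matrix.SpecialLinearGroup.SL2_inv_expl]; simp [matA]; rfl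
    have hB : (matB⁻¹ : SLC).1 = !![1, 0; omega, 1] := by
      rw [Matrix.SpecialLinearGroup.SL2_inv_expl]; simp [matB]; rfl
    apply Subtype.ext
    change matB.1 * (matA⁻¹.1 * matB.1 * matA.1 * matB⁻¹.1) =
      (matA⁻¹.1 * matB.1 * matA.1 * matB⁻¹.1) * matA.1
    rw [hA, hB]
    simp only [matA, matB, Matrix.mul_fin_two]
    congr 1
    ext i j
    fin_cases i <;> fin_cases j <;> simp
    all_goals grind [omega_relation]
  simp only [knotRelator, map_mul, map_inv, FreeGroup.lift_apply_of, meridianImage]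
  rw [← key]
  group

/-- The holonomy representation `ρ : π₁(S³ ∖ K) → SL₂(ℂ)`, `x ↦ A`, `y ↦ B`. -/
def holonomy : FigureEightGroup →* SLC := PresentedGroup.toGroup meridianImage_relator

/-- The holonomy group `Γ` of the canonical hyperbolic structure: `S³ ∖ K ≅ ℍ³ / Γ`. -/
def holonomyGroup : Subgroup SLC := holonomy.range

/-! ### Upper half-space

Hyperbolic space is `{(z, t) ∈ ℂ × ℝ ∣ 0 < t}` with the metric `(|dz|² + dt²) / t²`, oriented so
that `(1, 0), (i, 0), (0, 1)` is a right-handed basis of the tangent space `ℂ × ℝ` at each point. -/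

/-- The action of `SL₂(ℂ)` on upper half-space by orientation-preserving isometries (the Poincaré
extension of the Möbius action), given by its usual formula. -/
def act (g : SLC) (p : ℂ × ℝ) : ℂ × ℝ :=
  let a := g 0 0
  let b := g 0 1
  let c := g 1 0
  let d := g 1 1
  let r : ℝ := ‖c * p.1 + d‖ ^ 2 + ‖c‖ ^ 2 * p.2 ^ 2
  (((a * p.1 + b) * star (c * p.1 + d) + a * star c * (p.2 : ℂ) ^ 2) / (r : ℂ), p.2 / r)

/-- The derivative of the isometry `act g` at the point `p`. -/
def dact (g : SLC) (p : ℂ × ℝ) : ℂ × ℝ →L[ℝ] ℂ × ℝ := fderiv ℝ (act g) p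

/-- The horosphere of height `h` centred at `∞`. -/
def plane (h : ℝ) : Set (ℂ × ℝ) := {p | p.2 = h}

/-- The open horoball bounded by `plane h`. -/
def planeBall (h : ℝ) : Set (ℂ × ℝ) := {p | h < p.2}

/-! ### Frames and spin frames -/

/-- A right-handed orthonormal frame `(X, Y, X × Y)` at a point of hyperbolic space, recorded by the
point and by its first two vectors, which determine the third. -/
@[ext]
structure HFrame where
  /-- the base point -/
  pt : ℂ × ℝ
  /-- the first vector -/
  fst : ℂ × ℝ
  /-- the second vector -/
  snd : ℂ × ℝ

/-- The action of isometries on frames. -/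
def moveFrame (g : SLC) (F : HFrame) : HFrame :=
  ⟨act g F.pt, dact g F.pt F.fst, dact g F.pt F.snd⟩

/-- The base frame: at `(0, 1)`, with first vector pointing up to `∞` and second vector in the
direction `1 ∈ ℂ`. -/
def baseFrame : HFrame := ⟨(0, 1), (0, 1), (1, 0)⟩

/-- `PSL₂(ℂ)` acts simply transitively on frames, so `SL₂(ℂ)` is the (connected) double cover of the
frame bundle, by this covering map. Elements of `SL₂(ℂ)` in this role are called spin frames;
isometries act on them by left multiplication. -/
def spinProj (W : SLC) : HFrame := moveFrame W baseFrame

/-- `W * transport s` is the spin frame obtained from the spin frame `W` by parallel transport through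
the signed distance `s` along the geodesic tangent to the first vector of `W`. -/
def transport (s : ℝ) : SLC :=
  ⟨!![Complex.exp (s / 2), 0; 0, Complex.exp (-(s / 2))], by
    rw [Matrix.det_fin_two_of, ← Complex.exp_add]; simp⟩

/-- `W * rotFst φ` is the spin frame obtained from `W` by rotating through the angle `φ` about its
first vector; `φ` matters modulo `4π`. -/
def rotFst (φ : ℝ) : SLC :=
  ⟨!![Complex.exp (φ / 2 * Complex.I), 0; 0, Complex.exp (-(φ / 2 * Complex.I))], by
    rw [Matrix.det_fin_two_of, ← Complex.exp_add]; simp⟩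

/-- `W * rotSnd φ` is the spin frame obtained from `W` by rotating through the angle `φ` about its
second vector. -/
def rotSnd (φ : ℝ) : SLC :=
  ⟨!![Complex.cos (φ / 2), Complex.I * Complex.sin (φ / 2);
      Complex.I * Complex.sin (φ / 2), Complex.cos (φ / 2)], by
    rw [Matrix.det_fin_two_of]
    linear_combination Complex.sin_sq_add_cos_sq ((φ : ℂ) / 2) -
      Complex.sin ((φ : ℂ) / 2) ^ 2 * Complex.I_sq⟩

/-! ### Spin-decorated horospheres -/

/-- A horosphere with a decoration. Horospheres are the images of `plane 1` under isometries. As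
`w ↦ (w, 1)` is an isometry from the Euclidean plane to `plane 1`, the map `w ↦ act g (w, 1)` is one
to the horosphere, and the parallel fields are the images of the constant fields. The values of
the two fields off the horosphere are irrelevant. -/
structure DecoratedHorosphere where
  /-- the horosphere -/
  carrier : Set (ℂ × ℝ)
  /-- the unit normal field that points out of the horoball -/
  normal : ℂ × ℝ → ℂ × ℝ
  /-- the decoration, a parallel unit tangent field -/
  field : ℂ × ℝ → ℂ × ℝ
  spec : ∃ (g : SLC) (v : ℂ), ‖v‖ = 1 ∧ carrier = act g '' plane 1 ∧
    ∀ p ∈ plane 1, normal (act g p) = dact g p (0, -1) ∧ field (act g p) = dact g p (v, 0)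

namespace DecoratedHorosphere

/-- The inward frame field `(N, V, N × V)`, with `N` pointing out of the horoball. -/
def inFrame (h : DecoratedHorosphere) (p : ℂ × ℝ) : HFrame := ⟨p, h.normal p, h.field p⟩

/-- The outward frame field `(N, V, N × V)`, with `N` pointing into the horoball. -/
def outFrame (h : DecoratedHorosphere) (p : ℂ × ℝ) : HFrame := ⟨p, -h.normal p, h.field p⟩

/-- Horospheres with the same centre: some isometry carries both to horizontal planes. -/
def Concentric (h h' : DecoratedHorosphere) : Prop :=
  ∃ (g : SLC) (r r' : ℝ), 0 < r ∧ 0 < r' ∧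
    h.carrier = act g '' plane r ∧ h'.carrier = act g '' plane r'

end DecoratedHorosphere

/-- A spin-decorated horosphere: a decorated horosphere with continuous lifts `win`, `wout` of its
inward and outward frame fields to the spin frames, where `wout` is obtained from `win` by rotating
through `-π` about the decoration (and so `win` from `wout` by rotating through `π`). -/
structure SpinDecoratedHorosphere extends DecoratedHorosphere where
  /-- the inward spin-decoration -/
  win : ℂ × ℝ → SLC
  /-- the outward spin-decoration -/
  wout : ℂ × ℝ → SLC
  continuousOn_win : ContinuousOn win carrier
  continuousOn_wout : ContinuousOn wout carrier
  spinProj_win : ∀ p ∈ carrier, spinProj (win p) = toDecoratedHorosphere.inFrame p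
  spinProj_wout : ∀ p ∈ carrier, spinProj (wout p) = toDecoratedHorosphere.outFrame p
  associated : ∀ p ∈ carrier, wout p = win p * rotSnd (-Real.pi)

/-- `d = ρ + i θ` is a complex distance from `h` to `h'`: transporting the inward spin frame of `h` at
a point `p` through the signed distance `ρ` along the geodesic that leaves `h` orthogonally at `p`
(away from the centre of `h`), and then rotating it through `θ` about that geodesic, gives the outward
spin frame of `h'` at a point `p'`. In particular the geodesic runs from the centre of `h`
to that of `h'`, and meets the horospheres orthogonally in `p` and `p'`. -/
def IsComplexDistance (h h' : SpinDecoratedHorosphere) (d : ℂ) : Prop :=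
  ∃ p ∈ h.carrier, ∃ p' ∈ h'.carrier, ∃ ρ θ : ℝ,
    h'.wout p' = h.win p * transport ρ * rotFst θ ∧ d = ρ + θ * Complex.I

/-- `l` is the complex lambda length `exp (d / 2)` from `h` to `h'`, where `d` is the complex distance
from `h` to `h'`; it is `0` by convention when `h` and `h'` have the same centre. -/
def IsLambdaLength (h h' : SpinDecoratedHorosphere) (l : ℂ) : Prop :=
  (h.Concentric h'.toDecoratedHorosphere ∧ l = 0) ∨
    (¬ h.Concentric h'.toDecoratedHorosphere ∧
      ∃ d : ℂ, IsComplexDistance h h' d ∧ l = Complex.exp (d / 2))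

/-! ### The canonical horospheres of the figure eight knot complement -/

/-- The horoball of height `h` at `∞` covers an embedded cusp neighbourhood of `ℍ³ / Γ`: each of its
translates under `Γ` is equal to it or disjoint from it. (There is only one cusp: the vertices
`0, 1, -ω², ω` of the ideal fundamental domain all lie in the `Γ`-orbit of its vertex `∞`.) -/
def IsCuspHeight (h : ℝ) : Prop :=
  0 < h ∧ ∀ g ∈ holonomyGroup,
    act g '' planeBall h = planeBall h ∨ Disjoint (act g '' planeBall h) (planeBall h)

/-- `h` is the height of the horoball at `∞` that covers the maximal cusp neighbourhood. -/
def IsMaximalCuspHeight (h : ℝ) : Prop := IsLeast {r | IsCuspHeight r} h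

/-- The spin-decorated horospheres of the canonical hyperbolic structure: the horosphere bounds a lift
of the maximal cusp neighbourhood, thus is a `Γ`-translate of the one at `∞`, and the decoration is the
translate of the one at `∞` in the direction `i` (at height `h`, the unit vector `(h i, 0)`). Both
spin-decorations over this decoration are included. -/
def IsCanonical (h : SpinDecoratedHorosphere) : Prop :=
  ∃ r, IsMaximalCuspHeight r ∧ ∃ g ∈ holonomyGroup,
    h.carrier = act g '' plane r ∧
    ∀ p ∈ plane r, h.field (act g p) = dact g p (r * Complex.I, 0)

end

/-! Everything reduces to entries of matrices. Spin frames are elements of `SLC`, and a canonical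
spin-decorated horosphere is the image of one standard model, the plane of height 1 with direction
`i`, under some matrix `G`. Solving the defining equation of the complex distance for models `G` and
`G'` shows that the λ-length is the lower left entry of `G⁻¹ * G'` (`isLambdaLength_iff`). That
entry vanishes exactly when the centres agree, so the convention `λ = 0` fits.

The matrices `G` may be taken in `±Γ`, for two reasons. The maximal cusp has height 1
(`isMaximalCuspHeight_one`): nonzero lower left entries of `Γ` are Eisenstein integers, hence of
modulus at least 1, and `matB` attains 1. Moreover a continuous lift over a connected horosphere is
determined up to one global sign (`exists_isSpinFramedBy`). As `Γ` has Eisenstein entries, so does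
`G⁻¹ * G'`; this is the first claim.

For the second claim, `α` must be, up to a unit, the lower left entry of an element of `Γ`. The
Euclidean algorithm on the column `(1, α)` is run inside `Γ` (`exists_smul_column_eq`). A division
step with quotient `z` needs `g ∈ Γ` with `g ∞ = z` and `‖g 1 0‖ = 1`. Four explicit words together
with the translations by `1` and `2 + 4ω` supply such a `g` for every Eisenstein `z`. -/

noncomputable section

/-! ### The action on upper half-space -/

/-- The factor by which `act g` divides heights. -/
def actDenom (g : SLC) (p : ℂ × ℝ) : ℝ := ‖g 1 0 * p.1 + g 1 1‖ ^ 2 + ‖g 1 0‖ ^ 2 * p.2 ^ 2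

lemma det_eq_one (g : SLC) : g 0 0 * g 1 1 - g 0 1 * g 1 0 = 1 := by
  rw [← Matrix.det_fin_two]
  exact g.2

lemma act_snd (g : SLC) (p : ℂ × ℝ) : (act g p).2 = p.2 / actDenom g p := rfl

lemma act_fst (g : SLC) (p : ℂ × ℝ) :
    (act g p).1 = ((g 0 0 * p.1 + g 0 1) * star (g 1 0 * p.1 + g 1 1) +
      g 0 0 * star (g 1 0) * (p.2 : ℂ) ^ 2) / (actDenom g p : ℂ) := rfl

lemma actDenom_cast (g : SLC) (p : ℂ × ℝ) : (actDenom g p : ℂ) =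
    (g 1 0 * p.1 + g 1 1) * star (g 1 0 * p.1 + g 1 1) +
      g 1 0 * star (g 1 0) * (p.2 : ℂ) ^ 2 := by
  simp only [actDenom, Complex.star_def, Complex.mul_conj']
  push_cast
  ring

lemma actDenom_pos (g : SLC) {p : ℂ × ℝ} (hp : 0 < p.2) : 0 < actDenom g p := by
  unfold actDenom
  by_cases hc : g 1 0 = 0
  · have hd : g 1 1 ≠ 0 := by
      intro hd
      have := det_eq_one g
      simp [hc, hd] at this
    have : 0 < ‖g 1 1‖ := norm_pos_iff.2 hd
    simp only [hc, zero_mul, zero_add, norm_zero]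
    positivity
  · have : 0 < ‖g 1 0‖ := norm_pos_iff.2 hc
    positivity

lemma act_snd_pos (g : SLC) {p : ℂ × ℝ} (hp : 0 < p.2) : 0 < (act g p).2 :=
  div_pos hp (actDenom_pos g hp)

lemma mul_apply_eq (g h : SLC) (i j : Fin 2) : (g * h) i j = g i 0 * h 0 j + g i 1 * h 1 j := by
  rw [Matrix.SpecialLinearGroup.coe_mul, Matrix.mul_apply, Fin.sum_univ_two]

lemma slc_inv_apply (g : SLC) : g⁻¹ 0 0 = g 1 1 ∧ g⁻¹ 0 1 = -g 0 1 ∧ g⁻¹ 1 0 = -g 1 0 ∧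
    g⁻¹ 1 1 = g 0 0 := by
  rw [Matrix.SpecialLinearGroup.SL2_inv_expl]
  exact ⟨rfl, rfl, rfl, rfl⟩

lemma slc_ext {g h : SLC} (h00 : g 0 0 = h 0 0) (h01 : g 0 1 = h 0 1) (h10 : g 1 0 = h 1 0)
    (h11 : g 1 1 = h 1 1) : g = h := by
  ext i j
  fin_cases i <;> fin_cases j <;> assumption

/-- A consequence of `det g = 1` and its conjugate. Divided by `actDenom g p ^ 2`, it evaluates
`|z|² + t²` at the image point, the one quadratic quantity needed to compose two actions. -/
lemma act_numerator_identity (g : SLC) (p : ℂ × ℝ) :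
    ((g 0 0 * p.1 + g 0 1) * star (g 1 0 * p.1 + g 1 1) + g 0 0 * star (g 1 0) * (p.2 : ℂ) ^ 2) *
      star ((g 0 0 * p.1 + g 0 1) * star (g 1 0 * p.1 + g 1 1) +
        g 0 0 * star (g 1 0) * (p.2 : ℂ) ^ 2) + (p.2 : ℂ) ^ 2 =
    ((g 0 0 * p.1 + g 0 1) * star (g 0 0 * p.1 + g 0 1) + g 0 0 * star (g 0 0) * (p.2 : ℂ) ^ 2) *
      actDenom g p := by
  have h1 := det_eq_one g
  have h2 := congrArg star h1
  rw [actDenom_cast]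
  simp only [star_sub, star_mul', star_add, star_one, star_pow, Complex.star_def, Complex.conj_conj,
    Complex.conj_ofReal] at h2 ⊢
  generalize (starRingEnd ℂ) (g 0 0) = a' at *
  generalize (starRingEnd ℂ) (g 0 1) = b' at *
  generalize (starRingEnd ℂ) (g 1 0) = c' at *
  generalize (starRingEnd ℂ) (g 1 1) = d' at *
  generalize (starRingEnd ℂ) p.1 = z' at *
  linear_combination (-(p.2 : ℂ) ^ 2 * (a' * d' - b' * c')) * h1 - (p.2 : ℂ) ^ 2 * h2

lemma star_act_fst (g : SLC) (p : ℂ × ℝ) :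
    star (act g p).1 = star ((g 0 0 * p.1 + g 0 1) * star (g 1 0 * p.1 + g 1 1) +
      g 0 0 * star (g 1 0) * (p.2 : ℂ) ^ 2) / (actDenom g p : ℂ) := by
  rw [act_fst, Complex.star_def, map_div₀, Complex.conj_ofReal]

lemma actDenom_mul (g h : SLC) {p : ℂ × ℝ} (hp : 0 < p.2) :
    actDenom (g * h) p = actDenom g (act h p) * actDenom h p := by
  have hr : (actDenom h p : ℂ) ≠ 0 := by exact_mod_cast (actDenom_pos h hp).ne'
  have key := act_numerator_identity h p
  have hd := actDenom_cast h p
  have : (actDenom (g * h) p : ℂ) = actDenom g (act h p) * actDenom h p := by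
    rw [actDenom_cast, actDenom_cast g, act_snd]
    simp only [star_add (g 1 0 * _), star_mul' (g 1 0), star_act_fst]
    rw [act_fst, mul_apply_eq, mul_apply_eq]
    push_cast
    field_simp
    simp only [star_mul', star_add, star_pow, Complex.star_def, Complex.conj_conj,
      Complex.conj_ofReal] at key hd ⊢
    generalize (starRingEnd ℂ) (h 0 0) = a' at *
    generalize (starRingEnd ℂ) (h 0 1) = b' at *
    generalize (starRingEnd ℂ) (h 1 0) = c' at *
    generalize (starRingEnd ℂ) (h 1 1) = d' at *
    generalize (starRingEnd ℂ) p.1 = z' at *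
    generalize (actDenom h p : ℂ) = r at *
    linear_combination (-(g 1 0 * (starRingEnd ℂ) (g 1 0))) * key -
      (g 1 1 * (starRingEnd ℂ) (g 1 1) * r) * hd
  exact_mod_cast this

lemma act_mul (g h : SLC) {p : ℂ × ℝ} (hp : 0 < p.2) : act (g * h) p = act g (act h p) := by
  have hr : (actDenom h p : ℂ) ≠ 0 := by exact_mod_cast (actDenom_pos h hp).ne'
  have hr' : (actDenom g (act h p) : ℂ) ≠ 0 := by
    exact_mod_cast (actDenom_pos g (act_snd_pos h hp)).ne'
  have key := act_numerator_identity h p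
  have hd := actDenom_cast h p
  refine Prod.ext ?_ ?_
  · rw [act_fst (g * h), act_fst g, actDenom_mul g h hp, act_snd]
    simp only [star_add (g 1 0 * _), star_mul' (g 1 0), star_act_fst]
    rw [act_fst, mul_apply_eq, mul_apply_eq, mul_apply_eq, mul_apply_eq]
    push_cast
    field_simp
    simp only [star_mul', star_add, star_pow, Complex.star_def, Complex.conj_conj,
      Complex.conj_ofReal] at key hd ⊢
    generalize (starRingEnd ℂ) (h 0 0) = a' at *
    generalize (starRingEnd ℂ) (h 0 1) = b' at *
    generalize (starRingEnd ℂ) (h 1 0) = c' at *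
    generalize (starRingEnd ℂ) (h 1 1) = d' at *
    generalize (starRingEnd ℂ) p.1 = z' at *
    generalize (actDenom h p : ℂ) = r at *
    linear_combination (-(g 0 0 * (starRingEnd ℂ) (g 1 0))) * key -
      (g 0 1 * (starRingEnd ℂ) (g 1 1) * r) * hd
  · rw [act_snd, act_snd, act_snd, actDenom_mul g h hp, div_div, mul_comm]

lemma act_one (p : ℂ × ℝ) : act 1 p = p := by
  refine Prod.ext ?_ ?_ <;> simp [act]

lemma act_inv_act (g : SLC) {p : ℂ × ℝ} (hp : 0 < p.2) : act g⁻¹ (act g p) = p := by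
  rw [← act_mul _ _ hp, inv_mul_cancel, act_one]

lemma differentiableAt_act (g : SLC) {p : ℂ × ℝ} (hp : 0 < p.2) : DifferentiableAt ℝ (act g) p := by
  have hd := (actDenom_pos g hp).ne'
  have h1 : DifferentiableAt ℝ (fun p : ℂ × ℝ ↦ actDenom g p) p := by
    unfold actDenom
    exact (DifferentiableAt.norm_sq ℝ (by fun_prop)).add (by fun_prop)
  have h2 : DifferentiableAt ℝ (fun p : ℂ × ℝ ↦ (actDenom g p : ℂ)) p :=
    Complex.ofRealCLM.differentiableAt.comp p h1
  have h3 : DifferentiableAt ℝ (fun p : ℂ × ℝ ↦ (p.2 : ℂ)) p :=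
    Complex.ofRealCLM.differentiableAt.comp p differentiableAt_snd
  have h4 : DifferentiableAt ℝ (fun p : ℂ × ℝ ↦ star (g 1 0 * p.1 + g 1 1)) p :=
    DifferentiableAt.star (by fun_prop)
  have hd' : (actDenom g p : ℂ) ≠ 0 := by exact_mod_cast hd
  refine DifferentiableAt.prodMk (f₁ := fun p ↦ (act g p).1) (f₂ := fun p ↦ (act g p).2) ?_ ?_
  · simp only [act_fst, div_eq_mul_inv]
    refine DifferentiableAt.mul ?_ (h2.inv hd')
    fun_prop
  · simp only [act_snd, div_eq_mul_inv]
    exact differentiableAt_snd.mul (h1.inv hd)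

lemma hasDerivAt_act_line (g : SLC) {p : ℂ × ℝ} (hp : 0 < p.2) (v : ℂ × ℝ) :
    HasDerivAt (fun s : ℝ ↦ act g (p + s • v)) (dact g p v) 0 :=
  (differentiableAt_act g hp).hasFDerivAt.hasLineDerivAt v

lemma dact_eq_of_hasDerivAt {g : SLC} {p v w : ℂ × ℝ} (hp : 0 < p.2)
    (h : HasDerivAt (fun s : ℝ ↦ act g (p + s • v)) w 0) : dact g p v = w :=
  (hasDerivAt_act_line g hp v).unique h

lemma dact_mul (g h : SLC) {p : ℂ × ℝ} (hp : 0 < p.2) (v : ℂ × ℝ) :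
    dact (g * h) p v = dact g (act h p) (dact h p v) := by
  have he : act (g * h) =ᶠ[nhds p] act g ∘ act h := by
    filter_upwards [(isOpen_lt continuous_const continuous_snd).mem_nhds hp] with q hq
    exact act_mul g h hq
  rw [dact, he.fderiv_eq, fderiv_comp p (differentiableAt_act g (act_snd_pos h hp))
    (differentiableAt_act h hp)]
  rfl

lemma dact_one (p v : ℂ × ℝ) : dact 1 p v = v := by
  have : act 1 = id := funext act_one
  rw [dact, this, fderiv_id]
  rfl

lemma moveFrame_mul (g h : SLC) {F : HFrame} (hF : 0 < F.pt.2) :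
    moveFrame (g * h) F = moveFrame g (moveFrame h F) := by
  simp only [moveFrame, act_mul g h hF, dact_mul g h hF]

lemma moveFrame_one (F : HFrame) : moveFrame 1 F = F := by
  simp only [moveFrame, act_one, dact_one]

lemma spinProj_mul (g W : SLC) : spinProj (g * W) = moveFrame g (spinProj W) :=
  moveFrame_mul g W (by simp [baseFrame])

/-! ### Isometries that preserve horizontal planes -/

/-- If `c ≠ 0`, the points of `plane r` with `cz + d = 0` and `cz + d = 1` have denominators
differing by 1, so their images have different heights. -/
lemma lower_left_eq_zero_of_mapsTo {g : SLC} {r s : ℝ} (hr : 0 < r)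
    (h : Set.MapsTo (act g) (plane r) (plane s)) : g 1 0 = 0 := by
  by_contra hc
  have h1 : r / actDenom g (-g 1 1 / g 1 0, r) = s := h (show (_, r) ∈ plane r from rfl)
  have h2 : r / actDenom g ((1 - g 1 1) / g 1 0, r) = s := h (show (_, r) ∈ plane r from rfl)
  have h3 := actDenom_pos g (p := (-g 1 1 / g 1 0, r)) hr
  have h4 := actDenom_pos g (p := ((1 - g 1 1) / g 1 0, r)) hr
  rw [← h1, div_eq_div_iff h4.ne' h3.ne'] at h2
  have h5 := mul_left_cancel₀ hr.ne' h2
  simp [actDenom, mul_div_cancel₀ _ hc] at h5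

lemma upper_triangular_mul {g : SLC} (hc : g 1 0 = 0) : g 0 0 * g 1 1 = 1 := by
  simpa [hc] using det_eq_one g

lemma act_of_lower_left_eq_zero {g : SLC} (hc : g 1 0 = 0) (p : ℂ × ℝ) :
    act g p = (g 0 0 ^ 2 * p.1 + g 0 0 * g 0 1, ‖g 0 0‖ ^ 2 * p.2) := by
  have h := upper_triangular_mul hc
  have ha : g 0 0 ≠ 0 := left_ne_zero_of_mul_eq_one h
  have hd : g 1 1 = (g 0 0)⁻¹ := eq_inv_of_mul_eq_one_right h
  have hs : star (g 0 0) ≠ 0 := star_ne_zero.2 ha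
  refine Prod.ext ?_ ?_
  · rw [act_fst, actDenom_cast]
    simp only [hc, hd, star_zero, zero_mul, mul_zero, add_zero, zero_add, star_inv₀]
    field_simp
  · rw [act_snd, actDenom]
    have : ‖g 0 0‖ ≠ 0 := norm_ne_zero_iff.2 ha
    simp only [hc, hd, zero_mul, zero_add, norm_inv, norm_zero]
    field_simp
    ring

lemma dact_of_lower_left_eq_zero {g : SLC} (hc : g 1 0 = 0) {p : ℂ × ℝ} (hp : 0 < p.2)
    (v : ℂ × ℝ) : dact g p v = (g 0 0 ^ 2 * v.1, ‖g 0 0‖ ^ 2 * v.2) := by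
  refine dact_eq_of_hasDerivAt hp ?_
  simp only [act_of_lower_left_eq_zero hc, Prod.fst_add, Prod.snd_add, Prod.smul_fst,
    Prod.smul_snd, Complex.real_smul, smul_eq_mul]
  have h1 : HasDerivAt (fun s : ℝ ↦ (s : ℂ)) 1 0 := Complex.ofRealCLM.hasDerivAt
  have h2 := (((h1.mul_const v.1).const_add p.1).const_mul (g 0 0 ^ 2)).add_const (g 0 0 * g 0 1)
  have h3 := (((hasDerivAt_id (0 : ℝ)).mul_const v.2).const_add p.2).const_mul (‖g 0 0‖ ^ 2)
  exact (h2.prodMk h3).congr_deriv (by simp only [one_mul])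

lemma image_plane_of_lower_left_eq_zero {g : SLC} (hc : g 1 0 = 0) (r : ℝ) :
    act g '' plane r = plane (‖g 0 0‖ ^ 2 * r) := by
  have ha : g 0 0 ≠ 0 := left_ne_zero_of_mul_eq_one (upper_triangular_mul hc)
  have hn : ‖g 0 0‖ ^ 2 ≠ 0 := pow_ne_zero 2 (norm_ne_zero_iff.2 ha)
  ext p
  constructor
  · rintro ⟨q, hq, rfl⟩
    rw [act_of_lower_left_eq_zero hc]
    simp only [plane, Set.mem_ofPred_eq] at hq ⊢
    rw [hq]
  · intro hp
    refine ⟨((p.1 - g 0 0 * g 0 1) / g 0 0 ^ 2, r), rfl, ?_⟩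
    rw [act_of_lower_left_eq_zero hc]
    refine Prod.ext ?_ hp.symm
    field_simp
    ring

lemma image_planeBall_of_lower_left_eq_zero {g : SLC} (hc : g 1 0 = 0) (ha : ‖g 0 0‖ = 1) (r : ℝ) :
    act g '' planeBall r = planeBall r := by
  have ha' : g 0 0 ≠ 0 := left_ne_zero_of_mul_eq_one (upper_triangular_mul hc)
  ext p
  simp only [Set.mem_image, act_of_lower_left_eq_zero hc, ha, one_pow, one_mul, planeBall,
    Set.mem_ofPred_eq]
  constructor
  · rintro ⟨q, hq, rfl⟩
    exact hq
  · intro hp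
    refine ⟨((p.1 - g 0 0 * g 0 1) / g 0 0 ^ 2, p.2), hp, Prod.ext ?_ rfl⟩
    field_simp
    ring

/-! ### Spin frames -/

lemma neg_slc_apply (g : SLC) (i j : Fin 2) : (-g) i j = -g i j := by
  rw [Matrix.SpecialLinearGroup.coe_neg, Matrix.neg_apply]

/-- Fixing the point gives `|c|² + |d|² = 1`. The vertical derivative of the height is then `1 -
2|c|²`, so fixing the first vector forces `c = 0`. The point now gives `b = 0` and the second vector
`a² = 1`. -/
lemma eq_one_or_neg_one_of_spinProj {U : SLC} (h : spinProj U = baseFrame) : U = 1 ∨ U = -1 := by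
  have hpt : act U (0, 1) = (0, 1) := congrArg HFrame.pt h
  have hfst : dact U (0, 1) (0, 1) = (0, 1) := congrArg HFrame.fst h
  have hsnd : dact U (0, 1) (1, 0) = (1, 0) := congrArg HFrame.snd h
  have h01 : (0 : ℝ) < ((0, 1) : ℂ × ℝ).2 := one_pos
  have hden : ‖U 1 1‖ ^ 2 + ‖U 1 0‖ ^ 2 = 1 := by
    have h1 : 1 / actDenom U (0, 1) = 1 := congrArg Prod.snd hpt
    rw [div_eq_one_iff_eq (actDenom_pos U h01).ne'] at h1
    simpa [actDenom] using h1.symm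
  have hc : U 1 0 = 0 := by
    have h2 := (ContinuousLinearMap.snd ℝ ℂ ℝ).hasFDerivAt.comp_hasDerivAt (0 : ℝ)
      (hasDerivAt_act_line U h01 (0, 1))
    rw [hfst] at h2
    have h3 : HasDerivAt (fun s : ℝ ↦ (1 + s) / (‖U 1 1‖ ^ 2 + ‖U 1 0‖ ^ 2 * (1 + s) ^ 2))
        ((1 * (‖U 1 1‖ ^ 2 + ‖U 1 0‖ ^ 2 * (1 + 0) ^ 2) -
          (1 + 0) * (‖U 1 0‖ ^ 2 * (2 * (1 + 0)))) /
          (‖U 1 1‖ ^ 2 + ‖U 1 0‖ ^ 2 * (1 + 0) ^ 2) ^ 2) 0 := by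
      have e : HasDerivAt (fun s : ℝ ↦ 1 + s) 1 0 := (hasDerivAt_id (0 : ℝ)).const_add 1
      refine e.fun_div ?_ (by simp [hden])
      have := ((e.fun_pow 2).const_mul (‖U 1 0‖ ^ 2)).const_add (‖U 1 1‖ ^ 2)
      simpa using this
    have h4 : (fun s : ℝ ↦ (1 + s) / (‖U 1 1‖ ^ 2 + ‖U 1 0‖ ^ 2 * (1 + s) ^ 2)) =
        ContinuousLinearMap.snd ℝ ℂ ℝ ∘ fun s : ℝ ↦ act U ((0, 1) + s • (0, 1)) := by
      funext s
      simp [act]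
    rw [h4] at h3
    have h5 := h3.unique h2
    simp only [add_zero, one_pow, mul_one, hden, one_mul, div_one, ContinuousLinearMap.coe_snd'] at h5
    have : ‖U 1 0‖ ^ 2 = 0 := by linarith
    simpa using this
  have hb : U 0 0 * U 0 1 = 0 := by
    rw [act_of_lower_left_eq_zero hc] at hpt
    simpa using congrArg Prod.fst hpt
  have ha2 : U 0 0 ^ 2 = 1 := by
    rw [dact_of_lower_left_eq_zero hc h01] at hsnd
    simpa using congrArg Prod.fst hsnd
  have had := upper_triangular_mul hc
  rcases sq_eq_one_iff.1 ha2 with ha | ha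
  · left
    apply slc_ext <;> simp_all
  · right
    apply slc_ext <;> simp_all [neg_slc_apply]
    exact neg_eq_iff_eq_neg.1 had

lemma eq_or_eq_neg_of_spinProj_eq {W W' : SLC} (h : spinProj W' = spinProj W) :
    W' = W ∨ W' = -W := by
  have : spinProj (W⁻¹ * W') = baseFrame := by
    rw [spinProj_mul, h, ← spinProj_mul, inv_mul_cancel]
    exact moveFrame_one _
  rcases eq_one_or_neg_one_of_spinProj this with h | h
  · left
    rw [inv_mul_eq_one] at h
    exact h.symm
  · right
    rw [inv_mul_eq_iff_eq_mul] at h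
    simpa using h

/-- The parabolic isometry `z ↦ z + w`. -/
def parabolic (w : ℂ) : SLC := ⟨!![1, w; 0, 1], by simp⟩

/-- A square root of `-i`. -/
def sqrtNegI : ℂ := Complex.exp (-(Real.pi / 4 : ℝ) * Complex.I)

lemma sqrtNegI_sq : sqrtNegI ^ 2 = -Complex.I := by
  rw [sqrtNegI, ← Complex.exp_nat_mul]
  have : ((2 : ℕ) : ℂ) * (-(Real.pi / 4 : ℝ) * Complex.I) = -(Real.pi / 2 * Complex.I) := by
    push_cast
    ring
  rw [this, Complex.exp_neg, Complex.exp_pi_div_two_mul_I, Complex.inv_I]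

lemma sqrtNegI_ne_zero : sqrtNegI ≠ 0 := Complex.exp_ne_zero _

lemma norm_sqrtNegI : ‖sqrtNegI‖ = 1 := by
  rw [sqrtNegI, ← Complex.ofReal_neg, Complex.norm_exp_ofReal_mul_I]

lemma star_inv_sqrtNegI : star (sqrtNegI⁻¹) = sqrtNegI := by
  rw [Complex.star_def, Complex.inv_eq_conj norm_sqrtNegI, Complex.conj_conj]

/-- The spin frame at `(0, 1)` with first vector pointing down and second vector in the direction
`i`. -/
def downFrame : SLC := ⟨!![0, sqrtNegI; -sqrtNegI⁻¹, 0], by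
  rw [Matrix.det_fin_two_of]
  field_simp [sqrtNegI_ne_zero]
  ring⟩

/-- The rotation of the inward frame to the outward frame. -/
lemma rotSnd_neg_pi : (rotSnd (-Real.pi) : SLC).1 = !![0, -Complex.I; -Complex.I, 0] := by
  simp only [rotSnd]
  push_cast
  rw [neg_div, Complex.cos_neg, Complex.sin_neg, Complex.cos_pi_div_two, Complex.sin_pi_div_two]
  simp

/-- On the boundary `downFrame` is `z ↦ -sqrtNegI² / z = i / z`. On upper half-space this is
inversion in the unit sphere followed by the reflection `z ↦ i z̄`, which reverses the vertical at
`(0, 1)` and turns the direction `1` to `i`. -/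
lemma spinProj_downFrame : spinProj downFrame = ⟨(0, 1), (0, -1), (Complex.I, 0)⟩ := by
  have h00 : downFrame 0 0 = 0 := rfl
  have h01 : downFrame 0 1 = sqrtNegI := rfl
  have h10 : downFrame 1 0 = -sqrtNegI⁻¹ := rfl
  have h11 : downFrame 1 1 = 0 := rfl
  have hp : (0 : ℝ) < ((0, 1) : ℂ × ℝ).2 := one_pos
  have hact (p : ℂ × ℝ) : act downFrame p =
      (Complex.I * star p.1 / ((‖p.1‖ ^ 2 + p.2 ^ 2 : ℝ) : ℂ), p.2 / (‖p.1‖ ^ 2 + p.2 ^ 2)) := by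
    have : actDenom downFrame p = ‖p.1‖ ^ 2 + p.2 ^ 2 := by
      simp [actDenom, h10, h11, norm_sqrtNegI]
    refine Prod.ext ?_ ?_
    · rw [act_fst, this]
      congr 1
      simp only [h00, h01, h10, h11, add_zero, zero_mul, zero_add, star_mul', star_neg,
        star_inv_sqrtNegI]
      linear_combination (-star p.1) * sqrtNegI_sq
    · rw [act_snd, this]
  refine HFrame.ext ?_ ?_ ?_
  · simp [spinProj, moveFrame, baseFrame, hact]
  · refine dact_eq_of_hasDerivAt hp ?_
    simp only [hact]
    refine HasDerivAt.prodMk (f₁' := (0 : ℂ)) (f₂' := (-1 : ℝ)) ?_ ?_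
    · simpa [baseFrame] using hasDerivAt_const (0 : ℝ) (0 : ℂ)
    · have e : HasDerivAt (fun s : ℝ ↦ 1 + s) 1 0 := (hasDerivAt_id (0 : ℝ)).const_add 1
      have := e.fun_div (e.fun_pow 2) (by simp)
      refine (this.congr_deriv (by norm_num)).congr_of_eventuallyEq (.of_forall fun s ↦ ?_)
      simp [baseFrame]
  · refine dact_eq_of_hasDerivAt hp ?_
    simp only [hact]
    have e : HasDerivAt (fun s : ℝ ↦ s ^ 2 + 1) 0 0 := by
      simpa using ((hasDerivAt_id (0 : ℝ)).fun_pow 2).add_const 1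
    refine HasDerivAt.prodMk (f₁' := Complex.I) (f₂' := (0 : ℝ)) ?_ ?_
    · have h1 : HasDerivAt (fun s : ℝ ↦ (s : ℂ)) 1 0 := Complex.ofRealCLM.hasDerivAt
      have := (h1.const_mul Complex.I).fun_div e.ofReal_comp (by simp)
      refine (this.congr_deriv (by simp)).congr_of_eventuallyEq (.of_forall fun s ↦ ?_)
      simp [baseFrame]
    · have := (hasDerivAt_const (0 : ℝ) (1 : ℝ)).fun_div e (by simp)
      refine (this.congr_deriv (by simp)).congr_of_eventuallyEq (.of_forall fun s ↦ ?_)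
      simp [baseFrame]

lemma spinProj_parabolic_mul (w : ℂ) {W : SLC} {p : ℂ × ℝ} {u v : ℂ × ℝ} (hp : 0 < p.2)
    (h : spinProj W = ⟨p, u, v⟩) : spinProj (parabolic w * W) = ⟨(p.1 + w, p.2), u, v⟩ := by
  have h00 : parabolic w 0 0 = 1 := rfl
  have h01 : parabolic w 0 1 = w := rfl
  have h10 : parabolic w 1 0 = 0 := rfl
  rw [spinProj_mul, h]
  simp [moveFrame, act_of_lower_left_eq_zero h10, dact_of_lower_left_eq_zero h10 hp, h00, h01]

lemma downFrame_mul_rotSnd : (downFrame * rotSnd (-Real.pi)).1 =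
    !![-Complex.I * sqrtNegI, 0; 0, Complex.I * sqrtNegI⁻¹] := by
  change downFrame.1 * (rotSnd (-Real.pi)).1 = _
  rw [rotSnd_neg_pi]
  simp [downFrame, mul_comm]

lemma spinProj_downFrame_mul_rotSnd :
    spinProj (downFrame * rotSnd (-Real.pi)) = ⟨(0, 1), (0, 1), (Complex.I, 0)⟩ := by
  set U := downFrame * rotSnd (-Real.pi) with hU
  have h00 : U 0 0 = -Complex.I * sqrtNegI := congrFun (congrFun downFrame_mul_rotSnd 0) 0
  have h01 : U 0 1 = 0 := congrFun (congrFun downFrame_mul_rotSnd 0) 1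
  have h10 : U 1 0 = 0 := congrFun (congrFun downFrame_mul_rotSnd 1) 0
  have hsq : U 0 0 ^ 2 = Complex.I := by
    rw [h00, mul_pow, sqrtNegI_sq, neg_sq, Complex.I_sq]
    ring
  have hn : ‖U 0 0‖ = 1 := by simp [h00, norm_sqrtNegI]
  simp [spinProj, moveFrame, baseFrame, act_of_lower_left_eq_zero h10,
    dact_of_lower_left_eq_zero h10, hsq, hn, h01]

/-! ### Horospheres framed by a matrix -/

/-- The horosphere `h` is the image of `plane 1` under `G`, and its decoration is the image of the
direction `i`. -/
def DecoratedHorosphere.IsFramedBy (h : DecoratedHorosphere) (G : SLC) : Prop :=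
  h.carrier = act G '' plane 1 ∧ ∀ p ∈ plane 1, h.field (act G p) = dact G p (Complex.I, 0)

/-- In addition, the spin-decoration of `h` is the image of the standard one under `G`. -/
def SpinDecoratedHorosphere.IsSpinFramedBy (h : SpinDecoratedHorosphere) (G : SLC) : Prop :=
  h.carrier = act G '' plane 1 ∧ ∀ w : ℂ, h.win (act G (w, 1)) = G * (parabolic w * downFrame)

lemma plane_snd_pos {r : ℝ} (hr : 0 < r) {p : ℂ × ℝ} (hp : p ∈ plane r) : 0 < p.2 := by
  rw [show p.2 = r from hp]
  exact hr

/-- Two parametrizations of one horosphere differ by a matrix preserving horizontality, to which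
`lower_left_eq_zero_of_mapsTo` applies. -/
lemma mapsTo_of_image_eq {g G : SLC} {r s : ℝ} (hr : 0 < r) (hs : 0 < s)
    (h : act G '' plane r = act g '' plane s) : Set.MapsTo (act (g⁻¹ * G)) (plane r) (plane s) := by
  intro p hp
  obtain ⟨q, hq, hqp⟩ : act G p ∈ act g '' plane s := h ▸ Set.mem_image_of_mem _ hp
  rw [act_mul _ _ (plane_snd_pos hr hp), ← hqp, act_inv_act g (plane_snd_pos hs hq)]
  exact hq

/-- The normal field is specified through some other matrix `g`. The transition `g⁻¹ * G` is upper
triangular and preserves height 1, so it fixes the downward vector. -/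
lemma DecoratedHorosphere.IsFramedBy.normal_eq {h : DecoratedHorosphere} {G : SLC}
    (hG : h.IsFramedBy G) {p : ℂ × ℝ} (hp : p ∈ plane 1) :
    h.normal (act G p) = dact G p (0, -1) := by
  obtain ⟨g, v, -, hc, hf⟩ := h.spec
  have hm := mapsTo_of_image_eq one_pos one_pos (hG.1.symm.trans hc)
  have h0 := lower_left_eq_zero_of_mapsTo one_pos hm
  have hp0 := plane_snd_pos one_pos hp
  have hq := hm hp
  have hn : ‖(g⁻¹ * G) 0 0‖ ^ 2 = 1 := by
    rw [act_of_lower_left_eq_zero h0] at hq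
    have h1 : ‖(g⁻¹ * G) 0 0‖ ^ 2 * p.2 = 1 := hq
    rwa [show p.2 = 1 from hp, mul_one] at h1
  have e : G = g * (g⁻¹ * G) := by group
  have h1 : act G p = act g (act (g⁻¹ * G) p) := by rw [← act_mul _ _ hp0, ← e]
  have h2 : dact G p (0, -1) = dact g (act (g⁻¹ * G) p) (dact (g⁻¹ * G) p (0, -1)) := by
    rw [← dact_mul _ _ hp0, ← e]
  rw [h1, h2, (hf _ hq).1, dact_of_lower_left_eq_zero h0 hp0, hn]
  simp

lemma spinProj_standard (G : SLC) (w : ℂ) : spinProj (G * (parabolic w * downFrame)) =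
    ⟨act G (w, 1), dact G (w, 1) (0, -1), dact G (w, 1) (Complex.I, 0)⟩ := by
  rw [spinProj_mul, spinProj_parabolic_mul w one_pos spinProj_downFrame]
  simp [moveFrame]

lemma continuous_parabolic : Continuous parabolic := by
  refine Continuous.subtype_mk (continuous_matrix fun i j ↦ ?_) _
  fin_cases i <;> fin_cases j <;> simp <;> fun_prop

lemma act_neg (g : SLC) : act (-g) = act g := by
  funext p
  have h1 : -g 1 0 * p.1 + -g 1 1 = -(g 1 0 * p.1 + g 1 1) := by ring
  have hd : actDenom (-g) p = actDenom g p := by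
    simp only [actDenom, neg_slc_apply, h1, norm_neg]
  refine Prod.ext ?_ ?_
  · rw [act_fst, act_fst, hd]
    simp only [neg_slc_apply, h1, star_neg]
    ring
  · rw [act_snd, act_snd, hd]

/-- The lift `win` and the standard lift project to the same frames, so they differ by a sign at
each point; continuity over the connected plane makes the sign constant. -/
lemma SpinDecoratedHorosphere.exists_isSpinFramedBy {h : SpinDecoratedHorosphere} {G : SLC}
    (hG : h.IsFramedBy G) : h.IsSpinFramedBy G ∨ h.IsSpinFramedBy (-G) := by
  have hmem (w : ℂ) : act G (w, 1) ∈ h.carrier := by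
    rw [hG.1]
    exact ⟨_, rfl, rfl⟩
  have hcont : Continuous fun w : ℂ ↦ h.win (act G (w, 1)) := by
    refine h.continuousOn_win.comp_continuous ?_ hmem
    rw [continuous_iff_continuousAt]
    intro w
    exact (differentiableAt_act G (p := (w, 1)) one_pos).continuousAt.comp
      (f := fun w : ℂ ↦ (w, (1 : ℝ))) (by fun_prop)
  set U : ℂ → SLC := fun w ↦ (G * (parabolic w * downFrame))⁻¹ * h.win (act G (w, 1)) with hU
  have hUc : Continuous U :=
    (continuous_const.mul (continuous_parabolic.mul continuous_const)).inv.mul hcont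
  have hUe (w : ℂ) : h.win (act G (w, 1)) = G * (parabolic w * downFrame) * U w := by
    exact (mul_inv_cancel_left _ _).symm
  have hpm (w : ℂ) : U w = 1 ∨ U w = -1 := by
    have h1 : spinProj (h.win (act G (w, 1))) = spinProj (G * (parabolic w * downFrame)) := by
      rw [h.spinProj_win _ (hmem w), spinProj_standard]
      simp only [DecoratedHorosphere.inFrame, hG.normal_eq (p := (w, 1)) rfl, hG.2 (w, 1) rfl]
    rcases eq_or_eq_neg_of_spinProj_eq h1 with h2 | h2 <;> simp [hU, h2]
  -- The upper left entry of `U w = ±1` serves as a continuous sign function.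
  have hsign := isPreconnected_univ.eq_one_or_eq_neg_one_of_sq_eq (f := fun w ↦ U w 0 0)
    (by fun_prop) (fun w _ ↦ by rcases hpm w with h1 | h1 <;> simp [h1])
  rcases hsign with hs | hs
  · refine .inl ⟨hG.1, fun w ↦ ?_⟩
    have h00 : U w 0 0 = 1 := hs (Set.mem_univ w)
    rcases hpm w with h1 | h1
    · rw [hUe, h1, mul_one]
    · rw [h1] at h00
      norm_num at h00
  · refine .inr ⟨by rw [act_neg]; exact hG.1, fun w ↦ ?_⟩
    have h00 : U w 0 0 = -1 := hs (Set.mem_univ w)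
    rcases hpm w with h1 | h1
    · rw [h1] at h00
      norm_num at h00
    · rw [act_neg, hUe, h1]
      simp

/-- Every matrix frames a spin-decorated horosphere. -/
def framedHorosphere (G : SLC) : SpinDecoratedHorosphere where
  carrier := act G '' plane 1
  normal p := dact G (act G⁻¹ p) (0, -1)
  field p := dact G (act G⁻¹ p) (Complex.I, 0)
  spec := by
    refine ⟨G, Complex.I, Complex.norm_I, rfl, fun p hp ↦ ?_⟩
    rw [act_inv_act G (plane_snd_pos one_pos hp)]
    exact ⟨rfl, rfl⟩
  win p := G * (parabolic (act G⁻¹ p).1 * downFrame)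
  wout p := G * (parabolic (act G⁻¹ p).1 * downFrame) * rotSnd (-Real.pi)
  continuousOn_win := by
    rintro _ ⟨p, hp, rfl⟩
    have h1 := (differentiableAt_act G⁻¹
      (act_snd_pos G (plane_snd_pos one_pos hp))).continuousAt
    exact (continuousAt_const.mul ((continuous_parabolic.continuousAt.comp
      (continuousAt_fst.comp h1)).mul continuousAt_const)).continuousWithinAt
  continuousOn_wout := by
    rintro _ ⟨p, hp, rfl⟩
    have h1 := (differentiableAt_act G⁻¹
      (act_snd_pos G (plane_snd_pos one_pos hp))).continuousAt
    exact ((continuousAt_const.mul ((continuous_parabolic.continuousAt.comp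
      (continuousAt_fst.comp h1)).mul continuousAt_const)).mul
      continuousAt_const).continuousWithinAt
  spinProj_win := by
    rintro _ ⟨p, hp, rfl⟩
    simp only [DecoratedHorosphere.inFrame, act_inv_act G (plane_snd_pos one_pos hp)]
    rw [spinProj_standard, ← show p = (p.1, 1) from Prod.ext rfl hp]
  spinProj_wout := by
    rintro _ ⟨p, hp, rfl⟩
    simp only [DecoratedHorosphere.outFrame, act_inv_act G (plane_snd_pos one_pos hp)]
    rw [mul_assoc, mul_assoc, spinProj_mul,
      spinProj_parabolic_mul _ one_pos spinProj_downFrame_mul_rotSnd]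
    simp only [zero_add, moveFrame, ← show p = (p.1, 1) from Prod.ext rfl hp, ← map_neg,
      Prod.neg_mk, neg_zero, neg_neg]
  associated _ _ := rfl

lemma framedHorosphere_isFramedBy (G : SLC) : (framedHorosphere G).IsFramedBy G := by
  refine ⟨rfl, fun p hp ↦ ?_⟩
  simp only [framedHorosphere, act_inv_act G (plane_snd_pos one_pos hp)]

lemma framedHorosphere_isSpinFramedBy (G : SLC) : (framedHorosphere G).IsSpinFramedBy G := by
  refine ⟨rfl, fun w ↦ ?_⟩
  simp only [framedHorosphere, act_inv_act G (p := (w, 1)) one_pos]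

/-! ### Lambda lengths as matrix entries -/

lemma concentric_iff {h h' : DecoratedHorosphere} {G G' : SLC}
    (hG : h.carrier = act G '' plane 1) (hG' : h'.carrier = act G' '' plane 1) :
    h.Concentric h' ↔ (G⁻¹ * G') 1 0 = 0 := by
  constructor
  · rintro ⟨g, r, r', hr, hr', h1, h2⟩
    have e1 := lower_left_eq_zero_of_mapsTo one_pos
      (mapsTo_of_image_eq one_pos hr (hG.symm.trans h1))
    have e2 := lower_left_eq_zero_of_mapsTo one_pos
      (mapsTo_of_image_eq one_pos hr' (hG'.symm.trans h2))
    have e : G⁻¹ * G' = (g⁻¹ * G)⁻¹ * (g⁻¹ * G') := by group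
    rw [e, mul_apply_eq, e2, (slc_inv_apply _).2.2.1, e1]
    simp
  · intro h0
    have ha := left_ne_zero_of_mul_eq_one (upper_triangular_mul h0)
    refine ⟨G, 1, ‖(G⁻¹ * G') 0 0‖ ^ 2 * 1, one_pos, ?_, hG, ?_⟩
    · have := norm_pos_iff.2 ha
      positivity
    · rw [← image_plane_of_lower_left_eq_zero h0, hG', Set.image_image]
      refine Set.image_congr fun p hp ↦ ?_
      rw [← act_mul _ _ (plane_snd_pos one_pos hp), mul_inv_cancel_left]

lemma transport_mul_rotFst (ρ θ : ℝ) : (transport ρ * rotFst θ).1 =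
    !![Complex.exp ((ρ + θ * Complex.I) / 2), 0;
      0, (Complex.exp ((ρ + θ * Complex.I) / 2))⁻¹] := by
  change (transport ρ).1 * (rotFst θ).1 = _
  have e : ((ρ + θ * Complex.I) / 2 : ℂ) = ρ / 2 + θ / 2 * Complex.I := by ring
  rw [e, ← Complex.exp_neg, neg_add, Complex.exp_add, Complex.exp_add]
  simp [transport, rotFst]

/-- With `q = sqrtNegI`, the lower left entries of the frame equation read `-i q c = -q⁻¹ exp (d /
2)`, and `q² = -i` turns this into `exp (d / 2) = c`. The other entries only fix the feet of the
common perpendicular. -/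
lemma isComplexDistance_iff {h h' : SpinDecoratedHorosphere} {G G' : SLC}
    (hG : h.IsSpinFramedBy G) (hG' : h'.IsSpinFramedBy G') (d : ℂ) :
    IsComplexDistance h h' d ↔ Complex.exp (d / 2) = (G⁻¹ * G') 1 0 := by
  set M := G⁻¹ * G' with hM
  have hq := sqrtNegI_ne_zero
  have hq2 := sqrtNegI_sq
  have hI := Complex.I_sq
  have key (w w' : ℂ) (ρ θ : ℝ) :
      h'.wout (act G' (w', 1)) = h.win (act G (w, 1)) * transport ρ * rotFst θ ↔
        M * (parabolic w' * (downFrame * rotSnd (-Real.pi))) =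
          parabolic w * (downFrame * (transport ρ * rotFst θ)) := by
    rw [h'.associated _ (by rw [hG'.1]; exact ⟨_, rfl, rfl⟩), hG.2, hG'.2, hM]
    simp only [mul_assoc, inv_mul_eq_iff_eq_mul]
  have hL (w' : ℂ) : (parabolic w' * (downFrame * rotSnd (-Real.pi))).1 =
      !![-Complex.I * sqrtNegI, w' * (Complex.I * sqrtNegI⁻¹); 0, Complex.I * sqrtNegI⁻¹] := by
    change (parabolic w').1 * (downFrame * rotSnd (-Real.pi)).1 = _
    rw [downFrame_mul_rotSnd]
    simp [parabolic]
  have hR (w : ℂ) (ρ θ : ℝ) : (parabolic w * (downFrame * (transport ρ * rotFst θ))).1 =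
      !![-(w * sqrtNegI⁻¹ * Complex.exp ((ρ + θ * Complex.I) / 2)),
          sqrtNegI * (Complex.exp ((ρ + θ * Complex.I) / 2))⁻¹;
        -(sqrtNegI⁻¹ * Complex.exp ((ρ + θ * Complex.I) / 2)), 0] := by
    change (parabolic w).1 * (downFrame.1 * (transport ρ * rotFst θ).1) = _
    rw [transport_mul_rotFst]
    simp [parabolic, downFrame, mul_assoc]
  constructor
  · rintro ⟨p, hp, p', hp', ρ, θ, hw, rfl⟩
    rw [hG.1] at hp
    rw [hG'.1] at hp'
    obtain ⟨⟨w, t⟩, ht, rfl⟩ := hp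
    obtain ⟨⟨w', t'⟩, ht', rfl⟩ := hp'
    obtain rfl : t = 1 := ht
    obtain rfl : t' = 1 := ht'
    rw [key] at hw
    have h10 := congrArg (fun A : SLC ↦ A 1 0) hw
    simp only [mul_apply_eq M] at h10
    rw [hL, hR] at h10
    simp only [Matrix.of_apply, Matrix.cons_val', Matrix.cons_val_zero, Matrix.cons_val_one,
      Matrix.cons_val_fin_one, mul_zero, add_zero] at h10
    field_simp at h10
    rw [hq2] at h10
    rw [mul_comm Complex.I (θ : ℂ)] at h10
    linear_combination h10 - M 1 0 * hI
  · intro hd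
    have hc : M 1 0 ≠ 0 := hd ▸ Complex.exp_ne_zero _
    have hdet := det_eq_one M
    -- In the coordinates of each horosphere, the foot lies below `∞` over the centre of the other
    -- one: these centres are `M ∞ = a / c` and `M⁻¹ ∞ = -d / c`.
    refine ⟨act G (M 0 0 / M 1 0, 1), by rw [hG.1]; exact ⟨_, rfl, rfl⟩,
      act G' (-M 1 1 / M 1 0, 1), by rw [hG'.1]; exact ⟨_, rfl, rfl⟩, d.re, d.im, ?_,
      (Complex.re_add_im d).symm⟩
    rw [key]
    have hRe := hR (M 0 0 / M 1 0) d.re d.im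
    rw [Complex.re_add_im, hd] at hRe
    have hLe := hL (-M 1 1 / M 1 0)
    apply slc_ext <;> rw [mul_apply_eq M, hLe, hRe] <;>
      simp only [Matrix.of_apply, Matrix.cons_val', Matrix.cons_val_zero, Matrix.cons_val_one,
        Matrix.cons_val_fin_one, mul_zero, add_zero] <;> field_simp
    · linear_combination (-M 0 0 * Complex.I) * hq2 + M 0 0 * hI
    · linear_combination (-Complex.I) * hdet - hq2
    · linear_combination (-Complex.I) * hq2 + hI
    · ring

/-- The lambda length between framed horospheres is a matrix entry. -/
lemma isLambdaLength_iff {h h' : SpinDecoratedHorosphere} {G G' : SLC}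
    (hG : h.IsSpinFramedBy G) (hG' : h'.IsSpinFramedBy G') (l : ℂ) :
    IsLambdaLength h h' l ↔ l = (G⁻¹ * G') 1 0 := by
  rw [IsLambdaLength, concentric_iff hG.1 hG'.1]
  simp only [isComplexDistance_iff hG hG']
  by_cases h0 : (G⁻¹ * G') 1 0 = 0
  · simp [h0]
  · simp only [h0, false_and, not_false_eq_true, true_and, false_or]
    constructor
    · rintro ⟨d, hd, rfl⟩
      exact hd
    · rintro rfl
      refine ⟨2 * Complex.log ((G⁻¹ * G') 1 0), ?_⟩
      rw [mul_div_cancel_left₀ _ two_ne_zero, Complex.exp_log h0]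
      exact ⟨rfl, rfl⟩

/-! ### Eisenstein integers -/

lemma mem_eisenstein_iff {x : ℂ} : x ∈ eisenstein ↔ ∃ m n : ℤ, x = m + n * omega := by
  constructor
  · intro hx
    induction hx using Algebra.adjoin_induction with
    | mem x hx =>
      obtain rfl : x = omega := hx
      exact ⟨0, 1, by simp⟩
    | algebraMap r => exact ⟨r, 0, by simp⟩
    | add x y _ _ hx hy =>
      obtain ⟨a, b, rfl⟩ := hx
      obtain ⟨c, d, rfl⟩ := hy
      exact ⟨a + c, b + d, by push_cast; ring⟩
    | mul x y _ _ hx hy =>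
      obtain ⟨a, b, rfl⟩ := hx
      obtain ⟨c, d, rfl⟩ := hy
      refine ⟨a * c - b * d, a * d + b * c - b * d, ?_⟩
      push_cast
      linear_combination ((b : ℂ) * d) * omega_relation
  · rintro ⟨m, n, rfl⟩
    have ho : omega ∈ eisenstein := Algebra.subset_adjoin rfl
    exact add_mem (intCast_mem _ m) (mul_mem (intCast_mem _ n) ho)

lemma omega_re : omega.re = -1 / 2 := by simp [omega]

lemma omega_im : omega.im = Real.sqrt 3 / 2 := by simp [omega]

lemma omega_mem : omega ∈ eisenstein := Algebra.subset_adjoin rfl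

lemma normSq_add_mul_omega (x y : ℝ) :
    Complex.normSq (x + y * omega) = x ^ 2 - x * y + y ^ 2 := by
  have h : Real.sqrt 3 ^ 2 = 3 := Real.sq_sqrt (by norm_num)
  simp only [Complex.normSq_apply, Complex.add_re, Complex.add_im, Complex.mul_re, Complex.mul_im,
    Complex.ofReal_re, Complex.ofReal_im, omega_re, omega_im]
  linear_combination (y ^ 2 / 4) * h

lemma exists_normSq_eq_natCast {x : ℂ} (hx : x ∈ eisenstein) :
    ∃ n : ℕ, Complex.normSq x = n := by
  obtain ⟨a, b, rfl⟩ := mem_eisenstein_iff.1 hx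
  have h := normSq_add_mul_omega a b
  push_cast at h
  have h0 : 0 ≤ a ^ 2 - a * b + b ^ 2 := by nlinarith [sq_nonneg (a - b), sq_nonneg (a + b)]
  refine ⟨(a ^ 2 - a * b + b ^ 2).toNat, ?_⟩
  rw [h, ← Int.cast_natCast, Int.toNat_of_nonneg h0]
  push_cast
  ring

lemma one_le_norm_of_mem_eisenstein {x : ℂ} (hx : x ∈ eisenstein) (h0 : x ≠ 0) : 1 ≤ ‖x‖ := by
  obtain ⟨n, hn⟩ := exists_normSq_eq_natCast hx
  have h1 : 0 < Complex.normSq x := Complex.normSq_pos.2 h0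
  rw [hn] at h1
  have h2 : (1 : ℝ) ≤ n := by exact_mod_cast h1
  rw [← hn, Complex.normSq_eq_norm_sq] at h2
  nlinarith [norm_nonneg x]

/-- Every complex number is at distance less than `1` from an Eisenstein integer. -/
lemma exists_normSq_sub_lt_one (z : ℂ) :
    ∃ m n : ℤ, Complex.normSq (z - (m + n * omega)) < 1 := by
  have hs : Real.sqrt 3 ≠ 0 := by positivity
  set y : ℝ := 2 * z.im / Real.sqrt 3 with hy
  set x : ℝ := z.re + y / 2 with hx
  have hz : z = x + y * omega := by
    apply Complex.ext
    · simp [omega_re, omega_im, hx]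
      ring
    · simp [omega_re, omega_im, hy]
      field_simp
  -- Both coordinate errors are at most `1/2`, so the form `x² - xy + y²` is at most `3/4`.
  refine ⟨round x, round y, ?_⟩
  have h1 := abs_le.1 (abs_sub_round x)
  have h2 := abs_le.1 (abs_sub_round y)
  have e : z - ((round x : ℂ) + (round y : ℂ) * omega) =
      ((x - round x : ℝ) : ℂ) + ((y - round y : ℝ) : ℂ) * omega := by
    rw [hz]
    push_cast
    ring
  rw [e, normSq_add_mul_omega]
  nlinarith [h1.1, h1.2, h2.1, h2.2]

/-! ### The figure eight knot group acts transitively on the cusps -/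

lemma matA_mem : matA ∈ holonomyGroup :=
  ⟨PresentedGroup.of false, by simp [holonomy, meridianImage]⟩

lemma matB_mem : matB ∈ holonomyGroup :=
  ⟨PresentedGroup.of true, by simp [holonomy, meridianImage]⟩

lemma holonomyGroup_le_closure : holonomyGroup ≤ Subgroup.closure {matA, matB} := by
  rw [holonomyGroup, MonoidHom.range_eq_map, ← PresentedGroup.closure_range_of,
    MonoidHom.map_closure, Subgroup.closure_le]
  rintro _ ⟨_, ⟨b, rfl⟩, rfl⟩
  apply Subgroup.subset_closure
  cases b <;> simp [holonomy, meridianImage]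

lemma matA_val : matA.1 = !![1, 1; 0, 1] := rfl

lemma matB_val : matB.1 = !![1, 0; -omega, 1] := rfl

lemma matA_inv_val : (matA⁻¹).1 = !![1, -1; 0, 1] := by
  rw [Matrix.SpecialLinearGroup.SL2_inv_expl]
  simp [matA]
  rfl

lemma matB_inv_val : (matB⁻¹).1 = !![1, 0; omega, 1] := by
  rw [Matrix.SpecialLinearGroup.SL2_inv_expl]
  simp [matB]
  rfl

lemma apply_mem_eisenstein {g : SLC} (hg : g ∈ holonomyGroup) (i j : Fin 2) :
    g i j ∈ eisenstein := by
  have h := holonomyGroup_le_closure hg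
  clear hg
  induction h using Subgroup.closure_induction generalizing i j with
  | mem x hx =>
    rcases hx with rfl | rfl
    · rw [matA_val]
      fin_cases i <;> fin_cases j <;> simp [one_mem, zero_mem]
    · rw [matB_val]
      fin_cases i <;> fin_cases j <;> simp [one_mem, zero_mem, omega_mem]
  | one => fin_cases i <;> fin_cases j <;> simp [one_mem, zero_mem]
  | mul x y _ _ hx hy =>
    rw [mul_apply_eq]
    exact add_mem (mul_mem (hx _ _) (hy _ _)) (mul_mem (hx _ _) (hy _ _))
  | inv x _ hx =>
    obtain ⟨h00, h01, h10, h11⟩ := slc_inv_apply x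
    fin_cases i <;> fin_cases j
    · exact h00 ▸ hx 1 1
    · exact h01 ▸ neg_mem (hx 0 1)
    · exact h10 ▸ neg_mem (hx 1 0)
    · exact h11 ▸ hx 0 0

lemma norm_omega : ‖omega‖ = 1 := by
  have h := normSq_add_mul_omega 0 1
  simp [Complex.normSq_eq_norm_sq] at h
  exact h.resolve_right (by linarith [norm_nonneg omega])

lemma norm_one_add_omega : ‖1 + omega‖ = 1 := by
  have h := normSq_add_mul_omega 1 1
  simp [Complex.normSq_eq_norm_sq] at h
  exact h.resolve_right (by linarith [norm_nonneg (1 + omega)])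

/-- The points `g ∞`, for `g` in the holonomy group with `‖g 1 0‖ = 1`. -/
def IsFullSizeCentre (z : ℂ) : Prop :=
  ∃ g ∈ holonomyGroup, ‖g 1 0‖ = 1 ∧ g 0 0 = z * g 1 0

/-- Here `t` acts as `z ↦ z + b`. Its diagonal entry is allowed to differ from 1 because the
longitude has diagonal `-1`. -/
lemma IsFullSizeCentre.add_of_translation {t : SLC} (ht : t ∈ holonomyGroup) (h10 : t 1 0 = 0)
    {b : ℂ} (h00 : t 0 0 = t 1 1) (hb : t 0 1 = b * t 1 1) (h11 : ‖t 1 1‖ = 1) {z : ℂ}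
    (hz : IsFullSizeCentre z) : IsFullSizeCentre (z + b) := by
  obtain ⟨g, hg, h1, h2⟩ := hz
  refine ⟨t * g, mul_mem ht hg, ?_, ?_⟩
  · rw [mul_apply_eq, h10, zero_mul, zero_add, norm_mul, h1, h11, one_mul]
  · rw [mul_apply_eq, mul_apply_eq, h10, h2, hb, h00]
    ring

lemma IsFullSizeCentre.add_int_mul {t : SLC} (ht : t ∈ holonomyGroup) (h10 : t 1 0 = 0)
    {b : ℂ} (h00 : t 0 0 = t 1 1) (hb : t 0 1 = b * t 1 1) (h11 : ‖t 1 1‖ = 1) (n : ℤ) {z : ℂ}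
    (hz : IsFullSizeCentre z) : IsFullSizeCentre (z + n * b) := by
  obtain ⟨i00, i01, i10, i11⟩ := slc_inv_apply t
  induction n with
  | zero => simpa using hz
  | succ n ih =>
    have := ih.add_of_translation ht h10 h00 hb h11
    convert this using 1
    push_cast
    ring
  | pred n ih =>
    have := ih.add_of_translation (b := -b) (inv_mem ht) (by rw [i10, h10, neg_zero])
      (by rw [i00, i11, h00]) (by rw [i01, i11, hb, h00, neg_mul]) (by rw [i11, h00, h11])
    convert this using 1
    push_cast
    ring

/-- The relation `y = w x w⁻¹` makes `w` carry the fixed point `∞` of `matA` to the fixed point `0`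
of `matB`. -/
lemma isFullSizeCentre_zero : IsFullSizeCentre 0 := by
  have hv : (matA⁻¹ * matB * matA * matB⁻¹).1 = !![0, omega; 1 + omega, 1 - omega] := by
    change matA⁻¹.1 * matB.1 * matA.1 * matB⁻¹.1 = _
    rw [matA_inv_val, matB_val, matA_val, matB_inv_val]
    ext i j
    fin_cases i <;> fin_cases j <;> simp <;> grind [omega_relation]
  refine ⟨_, mul_mem (mul_mem (mul_mem (inv_mem matA_mem) matB_mem) matA_mem)
    (inv_mem matB_mem), ?_, ?_⟩
  · rw [hv]
    exact norm_one_add_omega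
  · rw [hv]
    simp

lemma isFullSizeCentre_omega : IsFullSizeCentre omega := by
  have hv : (matA⁻¹ * matB).1 = !![1 + omega, -1; -omega, 1] := by
    change matA⁻¹.1 * matB.1 = _
    rw [matA_inv_val, matB_val]
    simp
  refine ⟨_, mul_mem (inv_mem matA_mem) matB_mem, ?_, ?_⟩
  · rw [hv]
    simp [norm_omega]
  · rw [hv]
    simp
    linear_combination omega_relation

lemma isFullSizeCentre_neg_omega : IsFullSizeCentre (-omega) := by
  have hv : (matA * matB⁻¹).1 = !![1 + omega, 1; omega, 1] := by
    change matA.1 * matB⁻¹.1 = _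
    rw [matA_val, matB_inv_val]
    simp
  refine ⟨_, mul_mem matA_mem (inv_mem matB_mem), ?_, ?_⟩
  · rw [hv]
    simp [norm_omega]
  · rw [hv]
    simp
    linear_combination omega_relation

lemma isFullSizeCentre_two_omega : IsFullSizeCentre (2 * omega) := by
  have hv : (matA⁻¹ * matB * matA⁻¹ * matB⁻¹).1 =
      !![2, -2 - omega; -1 - omega, 1 + omega] := by
    change matA⁻¹.1 * matB.1 * matA⁻¹.1 * matB⁻¹.1 = _
    rw [matA_inv_val, matB_val, matB_inv_val]
    ext i j
    fin_cases i <;> fin_cases j <;> simp <;> grind [omega_relation]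
  refine ⟨_, mul_mem (mul_mem (mul_mem (inv_mem matA_mem) matB_mem) (inv_mem matA_mem))
    (inv_mem matB_mem), ?_, ?_⟩
  · rw [hv]
    change ‖-1 - omega‖ = 1
    rw [← norm_one_add_omega, ← norm_neg]
    congr 1
    ring
  · rw [hv]
    simp
    linear_combination 2 * omega_relation

/-- A longitude. -/
lemma exists_longitude : ∃ t ∈ holonomyGroup, t.1 = !![-1, -(2 + 4 * omega); 0, -1] := by
  -- The word is the inverse of `w` times the inverse of `w` read backwards.
  refine ⟨matB * (matA⁻¹ * matB⁻¹ * matA) * (matA * matB⁻¹ * matA⁻¹) * matB, ?_, ?_⟩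
  · have hA := matA_mem
    have hB := matB_mem
    have hA' := inv_mem hA
    have hB' := inv_mem hB
    exact mul_mem (mul_mem (mul_mem hB (mul_mem (mul_mem hA' hB') hA))
      (mul_mem (mul_mem hA hB') hA')) hB
  · change matB.1 * (matA⁻¹.1 * matB⁻¹.1 * matA.1) * (matA.1 * matB⁻¹.1 * matA⁻¹.1) * matB.1 = _
    rw [matA_inv_val, matB_val, matA_val, matB_inv_val]
    ext i j
    fin_cases i <;> fin_cases j <;> simp <;> grind [omega_relation]

/-- Every Eisenstein integer is the centre of a full-sized horoball. -/
lemma isFullSizeCentre_of_mem_eisenstein {z : ℂ} (hz : z ∈ eisenstein) : IsFullSizeCentre z := by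
  obtain ⟨m, n, rfl⟩ := mem_eisenstein_iff.1 hz
  obtain ⟨t, ht, htv⟩ := exists_longitude
  have hA (k : ℤ) {z : ℂ} (h : IsFullSizeCentre z) : IsFullSizeCentre (z + k) := by
    have := h.add_int_mul (b := 1) matA_mem rfl rfl (by simp [matA_val]) (by simp [matA_val]) k
    rwa [mul_one] at this
  have hT (k : ℤ) {z : ℂ} (h : IsFullSizeCentre z) :
      IsFullSizeCentre (z + k * (2 + 4 * omega)) :=
    h.add_int_mul ht (by simp [htv]) (by simp [htv]) (by simp [htv]) (by simp [htv]) k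
  -- Modulo the translations by `1` and `2 + 4ω`, only `n` modulo 4 matters, and `0, ω, 2ω, -ω`
  -- represent the four classes.
  have hr : n % 4 = 0 ∨ n % 4 = 1 ∨ n % 4 = 2 ∨ n % 4 = 3 := by omega
  have hn : (n : ℂ) = 4 * ((n / 4 : ℤ) : ℂ) + ((n % 4 : ℤ) : ℂ) := by
    exact_mod_cast (Int.mul_ediv_add_emod n 4).symm
  rcases hr with h | h | h | h <;> rw [h] at hn <;> push_cast at hn
  · convert hA (m - 2 * (n / 4)) (hT (n / 4) isFullSizeCentre_zero) using 1
    push_cast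
    linear_combination omega * hn
  · convert hA (m - 2 * (n / 4)) (hT (n / 4) isFullSizeCentre_omega) using 1
    push_cast
    linear_combination omega * hn
  · convert hA (m - 2 * (n / 4)) (hT (n / 4) isFullSizeCentre_two_omega) using 1
    push_cast
    linear_combination omega * hn
  -- Remainder 3 is represented by `-ω`, so one more longitude is needed.
  · convert hA (m - 2 * (n / 4 + 1)) (hT (n / 4 + 1) isFullSizeCentre_neg_omega) using 1
    push_cast
    linear_combination omega * hn

/-- The holonomy group acts transitively on the cusps, by descent as in the Euclidean algorithm. -/
lemma exists_smul_column_eq (n : ℕ) {α β : ℂ} (hα : α ∈ eisenstein) (hβ : β ∈ eisenstein)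
    (hn : Complex.normSq α = n) :
    ∃ g ∈ holonomyGroup, ∃ δ ∈ eisenstein, β = δ * g 0 0 ∧ α = δ * g 1 0 := by
  induction n using Nat.strong_induction_on generalizing α β with
  | _ n ih =>
    by_cases h0 : α = 0
    · exact ⟨1, one_mem _, β, hβ, by simp, by simp [h0]⟩
    -- With `z` the rounded quotient and `g ∞ = z`, the second entry of `g⁻¹ (β, α)` is `-(g 1 0) α
    -- (β / α - z)`. Since `‖g 1 0‖ = 1`, it is strictly smaller than `α`.
    obtain ⟨k, l, hkl⟩ := exists_normSq_sub_lt_one (β / α)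
    have hz : (k + l * omega : ℂ) ∈ eisenstein := mem_eisenstein_iff.2 ⟨k, l, rfl⟩
    obtain ⟨g, hg, hg1, hg2⟩ := isFullSizeCentre_of_mem_eisenstein hz
    have he := apply_mem_eisenstein hg
    have hα' : g 0 0 * α - g 1 0 * β ∈ eisenstein :=
      sub_mem (mul_mem (he _ _) hα) (mul_mem (he _ _) hβ)
    obtain ⟨m, hm⟩ := exists_normSq_eq_natCast hα'
    have hlt : m < n := by
      have e : g 0 0 * α - g 1 0 * β = -(g 1 0 * α * (β / α - (k + l * omega))) := by
        rw [hg2]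
        field_simp
        ring
      have h1 : (m : ℝ) < n := by
        rw [← hm, ← hn, e, Complex.normSq_neg, Complex.normSq_mul, Complex.normSq_mul,
          Complex.normSq_eq_norm_sq (g 1 0), hg1]
        nlinarith [Complex.normSq_pos.2 h0]
      exact_mod_cast h1
    obtain ⟨f, hf, δ, hδ, h1, h2⟩ := ih m hlt (β := g 1 1 * β - g 0 1 * α) hα'
      (sub_mem (mul_mem (he _ _) hβ) (mul_mem (he _ _) hα)) hm
    have hdet := det_eq_one g
    refine ⟨g * f, mul_mem hg hf, δ, hδ, ?_, ?_⟩ <;> rw [mul_apply_eq]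
    · linear_combination (-β) * hdet + g 0 0 * h1 + g 0 1 * h2
    · linear_combination (-α) * hdet + g 1 0 * h1 + g 1 1 * h2

/-- For the column `(1, α) = δ (g 0 0, g 1 0)`, the factor `δ` divides 1, so `u = g 0 0` is a unit
and `u α = g 1 0`. -/
lemma exists_unit_mul_eq_lower_left (α : eisenstein) : ∃ u : eisensteinˣ, ∃ g ∈ holonomyGroup,
    ((u : eisenstein) * α : eisenstein) = g 1 0 := by
  obtain ⟨n, hn⟩ := exists_normSq_eq_natCast α.2
  obtain ⟨g, hg, δ, hδ, h1, h2⟩ := exists_smul_column_eq n α.2 (one_mem _) hn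
  refine ⟨⟨⟨g 0 0, apply_mem_eisenstein hg 0 0⟩, ⟨δ, hδ⟩, Subtype.ext ?_, Subtype.ext ?_⟩, g, hg, ?_⟩
  · simp [h1, mul_comm]
  · simp [h1]
  · change g 0 0 * (α : ℂ) = g 1 0
    linear_combination g 0 0 * h2 - g 1 0 * h1

/-! ### The maximal cusp -/

/-- The diagonal entries are Eisenstein integers with product 1, and neither has modulus below 1. -/
lemma norm_upper_left_eq_one {g : SLC} (hg : g ∈ holonomyGroup) (hc : g 1 0 = 0) :
    ‖g 0 0‖ = 1 := by
  have h := upper_triangular_mul hc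
  have ha := one_le_norm_of_mem_eisenstein (apply_mem_eisenstein hg 0 0)
    (left_ne_zero_of_mul_eq_one h)
  have hd := one_le_norm_of_mem_eisenstein (apply_mem_eisenstein hg 1 1)
    (right_ne_zero_of_mul_eq_one h)
  have hn : ‖g 0 0‖ * ‖g 1 1‖ = 1 := by rw [← norm_mul, h, norm_one]
  nlinarith

/-- If `c ≠ 0` then `|c| ≥ 1`, so a point of height `t > 1` goes to height at most `1 / t < 1`. -/
lemma isCuspHeight_one : IsCuspHeight 1 := by
  refine ⟨one_pos, fun g hg ↦ ?_⟩
  by_cases hc : g 1 0 = 0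
  · exact .inl (image_planeBall_of_lower_left_eq_zero hc (norm_upper_left_eq_one hg hc) 1)
  · right
    rw [Set.disjoint_left]
    rintro _ ⟨p, hp, rfl⟩ hq
    have hp1 : 1 < p.2 := hp
    have hq1 : 1 < p.2 / actDenom g p := hq
    rw [one_lt_div (actDenom_pos g (one_pos.trans hp1))] at hq1
    have hn := one_le_norm_of_mem_eisenstein (apply_mem_eisenstein hg 1 0) hc
    have h1 : p.2 ^ 2 ≤ actDenom g p := by
      unfold actDenom
      have := one_le_pow₀ (n := 2) hn
      nlinarith [sq_nonneg ‖g 1 0 * p.1 + g 1 1‖, sq_nonneg p.2]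
    nlinarith

/-- Over `ω⁻¹`, where `cz + d` vanishes for `matB`, heights go from `t` to `t⁻¹`. For `r < 1`, the
point of height 1 shows that the two balls meet, and the one of height `r⁻¹` that they differ. -/
lemma isMaximalCuspHeight_one : IsMaximalCuspHeight 1 := by
  refine ⟨isCuspHeight_one, fun r hr ↦ ?_⟩
  obtain ⟨hr0, hr⟩ := hr
  by_contra! hr1
  have ho : omega ≠ 0 := norm_ne_zero_iff.1 (by rw [norm_omega]; exact one_ne_zero)
  have hh (t : ℝ) (ht : 0 < t) : (act matB (omega⁻¹, t)).2 = t⁻¹ := by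
    rw [act_snd, actDenom]
    simp [matB_val, ho, norm_omega]
    field_simp
  rcases hr matB matB_mem with h | h
  · have h1 : act matB (omega⁻¹, r⁻¹) ∈ planeBall r := by
      rw [← h]
      exact ⟨_, hr1.trans ((one_lt_inv₀ hr0).2 hr1), rfl⟩
    have h2 : r < (act matB (omega⁻¹, r⁻¹)).2 := h1
    rw [hh _ (inv_pos.2 hr0), inv_inv] at h2
    exact h2.false
  · refine Set.disjoint_left.1 h ⟨(omega⁻¹, 1), hr1, rfl⟩ ?_
    change r < (act matB (omega⁻¹, 1)).2
    rwa [hh 1 one_pos, inv_one]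

lemma isCanonical_iff (h : SpinDecoratedHorosphere) :
    IsCanonical h ↔ ∃ g ∈ holonomyGroup, h.IsFramedBy g := by
  constructor
  · rintro ⟨r, hr, g, hg, h1, h2⟩
    obtain rfl : r = 1 := hr.unique isMaximalCuspHeight_one
    exact ⟨g, hg, h1, by simpa using h2⟩
  · rintro ⟨g, hg, h1, h2⟩
    exact ⟨1, isMaximalCuspHeight_one, g, hg, h1, by simpa using h2⟩

lemma IsCanonical.exists_isSpinFramedBy {h : SpinDecoratedHorosphere} (hh : IsCanonical h) :
    ∃ G : SLC, h.IsSpinFramedBy G ∧ ∀ i j, G i j ∈ eisenstein := by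
  obtain ⟨g, hg, hf⟩ := (isCanonical_iff h).1 hh
  rcases SpinDecoratedHorosphere.exists_isSpinFramedBy hf with hs | hs
  · exact ⟨g, hs, apply_mem_eisenstein hg⟩
  · refine ⟨-g, hs, fun i j ↦ ?_⟩
    rw [neg_slc_apply]
    exact neg_mem (apply_mem_eisenstein hg i j)

lemma isCanonical_framedHorosphere {g : SLC} (hg : g ∈ holonomyGroup) :
    IsCanonical (framedHorosphere g) :=
  (isCanonical_iff _).2 ⟨g, hg, framedHorosphere_isFramedBy g⟩

end

theorem theorem1p2 :
    (∀ h h' : SpinDecoratedHorosphere, IsCanonical h → IsCanonical h' →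
      (∃! l : ℂ, IsLambdaLength h h' l) ∧ ∀ l : ℂ, IsLambdaLength h h' l → l ∈ eisenstein) ∧
    (∀ α : eisenstein, ∃ u : eisensteinˣ, ∃ h h' : SpinDecoratedHorosphere,
      IsCanonical h ∧ IsCanonical h' ∧ IsLambdaLength h h' ((u : eisenstein) * α : eisenstein)) := by
  constructor
  · intro h h' hh hh'
    obtain ⟨G, hG, hGe⟩ := hh.exists_isSpinFramedBy
    obtain ⟨G', hG', hGe'⟩ := hh'.exists_isSpinFramedBy
    simp only [isLambdaLength_iff hG hG', existsUnique_eq, true_and, forall_eq]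
    obtain ⟨-, -, h10, h11⟩ := slc_inv_apply G
    rw [mul_apply_eq, h10, h11]
    exact add_mem (mul_mem (neg_mem (hGe 1 0)) (hGe' 0 0)) (mul_mem (hGe 0 0) (hGe' 1 0))
  · intro α
    obtain ⟨u, g, hg, hu⟩ := exists_unit_mul_eq_lower_left α
    -- Starting from the horosphere at `∞`, the λ-length to the translate by `g` is `g 1 0` itself.
    refine ⟨u, framedHorosphere 1, framedHorosphere g, isCanonical_framedHorosphere (one_mem _),
      isCanonical_framedHorosphere hg, ?_⟩
    rw [isLambdaLength_iff (framedHorosphere_isSpinFramedBy 1) (framedHorosphere_isSpinFramedBy g),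
      inv_one, one_mul]
    exact hu
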